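/- There is an absolute constant $C>0$ such that for every totally ordered alphabet $\Sigma$ and every string $w\in\Sigma^*$ of length $n\ge 2$, $$ r_B(w)\;\le\; C\cdot z(w)\cdot \log_2^2 n , $$ i.e. $r_B=O(z\log^2 n)$, where $r_B(w)$ and $z(w)$ are defined as follows. Let $\prec$ be the lexicographic order on strings. A Lyndon word is a nonempty string that is lexicographically smaller than all of its proper nonempty suffixes, and the Lyndon factorization of $w$ is the unique way of writing $w$ as a concatenation of a lexicographically non-increasing sequence of Lyndon words (the Lyndon factors of $w$, listed with multiplicity). For nonempty strings $x,y$, the $\omega$-order compares the infinite strings $x^\infty=xxx\cdots$ and $y^\infty=yyy\cdots$ lexicographically. The bijective Burrows--Wheeler transform $\mathsf{BBWT}(w)$ is the string obtained by concatenating the last symbols of all cyclic rotations of all Lyndon factors of $w$ (each factor $f$, taken with multiplicity, contributes its $|f|$ rotations), sorted in $\omega$-order. The number $r_B(w)$ is the number of maximal runs of equal symbols in $\mathsf{BBWT}(w)$. The number $z(w)$ is the number of factors of the LZ77 factorization of $w$, obtained greedily from left to right: the factor starting at position $i$ is the longest prefix of $w[i..n]$ that also occurs in $w$ starting at some position $j<i$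 (the two occurrences may overlap), or the single symbol $w[i]$ if that longest prefix is empty. -/

import Mathlib

namespace Strings

variable {α : Type*} [LinearOrder α]

/-! ### Lyndon words and the Lyndon factorization -/

/-- A Lyndon word: a nonempty string that is lexicographically smaller than all of its proper
nonempty suffixes. -/
def IsLyndon (x : List α) : Prop :=
  x ≠ [] ∧ ∀ s : List α, s <:+ x → s ≠ [] → s ≠ x → x < s

/-- `fs` is a decomposition of `w` into a lexicographically non-increasing sequence of Lyndon
words (repeated factors are listed with their multiplicity). -/
def IsLyndonFactorization (w : List α) (fs : List (List α)) : Prop :=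
  fs.flatten = w ∧ (∀ f ∈ fs, IsLyndon f) ∧ fs.Pairwise (fun f g => g ≤ f)

theorem append_lt_append_of_lt {a b : List α} (h : a < b) (hp : ¬ a <+: b) (c d : List α) :
    a ++ c < b ++ d := by
  induction a generalizing b with
  | nil => exact absurd List.nil_prefix hp
  | cons x a ih =>
    cases b with
    | nil => simp at h
    | cons y b =>
      rw [List.cons_lt_cons_iff] at h
      rw [List.cons_append, List.cons_append, List.cons_lt_cons_iff]
      rcases h with h | ⟨rfl, h⟩
      · exact Or.inl h
      · refine Or.inr ⟨rfl, ih h fun hq => hp ?_⟩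
        simpa [List.cons_prefix_cons] using hq

theorem le_of_isPrefix {a b : List α} (h : a <+: b) : a ≤ b := by
  induction a generalizing b with
  | nil => exact not_lt.1 (by simp)
  | cons x a ih =>
    cases b with
    | nil => simp at h
    | cons y b =>
      rw [List.cons_prefix_cons] at h
      obtain ⟨rfl, h⟩ := h
      have := ih h
      rw [← not_lt] at this ⊢
      rw [List.cons_lt_cons_iff]
      simpa using this

theorem append_lt_append_left (s : List α) {a b : List α} (h : a < b) : s ++ a < s ++ b := by
  induction s with
  | nil => simpa using h
  | cons x s ih =>
    rw [List.cons_append, List.cons_append, List.cons_lt_cons_iff]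
    exact Or.inr ⟨rfl, ih⟩

theorem isLyndon_singleton (a : α) : IsLyndon [a] := by
  refine ⟨by simp, fun s hs h0 h1 => ?_⟩
  rw [List.suffix_cons_iff] at hs
  rcases hs with h | h
  · exact absurd h h1
  · exact absurd (List.suffix_nil.1 h) h0

theorem IsLyndon.append {u v : List α} (hu : IsLyndon u) (hv : IsLyndon v) (h : u < v) :
    IsLyndon (u ++ v) := by
  refine ⟨by simp [hu.1], fun s hs h0 h1 => ?_⟩
  have huv : u ++ v < v := by
    by_cases hp : u <+: v
    · obtain ⟨t, rfl⟩ := hp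
      have ht : t ≠ [] := by rintro rfl; simp at h
      refine append_lt_append_left u (hv.2 t (List.suffix_append u t) ht fun e => ?_)
      have := congrArg List.length e
      simp only [List.length_append] at this
      exact hu.1 (List.length_eq_zero_iff.1 (by omega))
    · simpa using append_lt_append_of_lt h hp v []
  have hs2 : s <:+ v ∨ ∃ s', s = s' ++ v ∧ s' <:+ u := by
    obtain ⟨r, hr⟩ := hs
    rcases List.append_eq_append_iff.1 hr with ⟨a, h2, h3⟩ | ⟨c, h2, h3⟩
    · exact Or.inr ⟨a, h3, ⟨r, h2.symm⟩⟩
    · exact Or.inl ⟨c, h3.symm⟩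
  clear hs
  rcases hs2 with hs | ⟨s', rfl, hs⟩
  · by_cases e : s = v
    · rw [e]; exact huv
    · exact huv.trans (hv.2 s hs h0 e)
  · by_cases e : s' = []
    · subst e; simpa using huv
    · have hne : s' ≠ u := by rintro rfl; exact h1 rfl
      refine append_lt_append_of_lt (hu.2 s' hs e hne) (fun hp => hne ?_) v v
      exact hs.eq_of_length (le_antisymm hs.length_le hp.length_le)

theorem exists_isLyndonFactorization_append (fs : List (List α)) (x : List α) (hx : IsLyndon x)
    (h : IsLyndonFactorization fs.flatten fs) :
    ∃ gs, IsLyndonFactorization (x ++ fs.flatten) gs := by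
  induction fs generalizing x with
  | nil => exact ⟨[x], by simp, by simpa using hx, by simp⟩
  | cons f fs ih =>
    obtain ⟨-, hL, hP⟩ := h
    rw [List.pairwise_cons] at hP
    rcases lt_or_ge x f with hlt | hge
    · have := ih (x ++ f) (hx.append (hL f (by simp)) hlt)
        ⟨rfl, fun g hg => hL g (by simp [hg]), hP.2⟩
      simpa using this
    · refine ⟨x :: f :: fs, by simp, ?_, ?_⟩
      · intro g hg
        rcases List.mem_cons.1 hg with rfl | hg
        · exact hx
        · exact hL g hg
      · rw [List.pairwise_cons, List.pairwise_cons]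
        refine ⟨fun g hg => ?_, hP⟩
        rcases List.mem_cons.1 hg with rfl | hg
        · exact hge
        · exact (hP.1 g hg).trans hge

theorem exists_isLyndonFactorization (w : List α) : ∃ fs, IsLyndonFactorization w fs := by
  induction w with
  | nil => exact ⟨[], by simp, by simp, by simp⟩
  | cons a w ih =>
    obtain ⟨fs, rfl, h⟩ := ih
    exact exists_isLyndonFactorization_append fs [a] (isLyndon_singleton a) ⟨rfl, h⟩

theorem exists_suffix_le {f : List α} (fs : List (List α)) (hfs : ∀ g ∈ fs, g ≤ f) (t : List α)
    (ht : t ≠ []) (h : t <+: fs.flatten) : ∃ p, p <:+ t ∧ p ≠ [] ∧ p ≤ f := by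
  induction fs generalizing t with
  | nil => exact absurd (by simpa using h) ht
  | cons g fs ih =>
    rw [List.flatten_cons] at h
    have h2 : t <+: g ∨ ∃ t', t = g ++ t' ∧ t' <+: fs.flatten := by
      obtain ⟨r, hr⟩ := h
      rcases List.append_eq_append_iff.1 hr with ⟨a, h2, h3⟩ | ⟨c, h2, h3⟩
      · exact Or.inl ⟨a, h2.symm⟩
      · exact Or.inr ⟨c, h2, ⟨r, h3.symm⟩⟩
    clear h
    rcases h2 with h | ⟨t', rfl, h⟩
    · exact ⟨t, List.suffix_rfl, ht, (le_of_isPrefix h).trans (hfs g (by simp))⟩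
    · by_cases e : t' = []
      · subst e
        exact ⟨g, by simp, by simpa using ht, hfs g (by simp)⟩
      · obtain ⟨p, hp, h0, hle⟩ := ih (fun k hk => hfs k (by simp [hk])) t' e h
        exact ⟨p, hp.trans (List.suffix_append _ _), h0, hle⟩

theorem isLyndonFactorization_length_le {w f g : List α} {fs gs : List (List α)}
    (hf : IsLyndonFactorization w (f :: fs)) (hg : IsLyndonFactorization w (g :: gs)) :
    g.length ≤ f.length := by
  by_contra! hlt
  obtain ⟨hfw, -, hfP⟩ := hf
  obtain ⟨hgw, hgL, -⟩ := hg
  rw [List.flatten_cons] at hfw hgw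
  have hpre : f <+: g := List.prefix_of_prefix_length_le (l₃ := w)
    ⟨_, hfw⟩ ⟨_, hgw⟩ hlt.le
  have hfg := le_of_isPrefix hpre
  obtain ⟨t, rfl⟩ := hpre
  have ht : t ≠ [] := by rintro rfl; simp at hlt
  have heq : t ++ gs.flatten = fs.flatten := by
    rw [← hfw, List.append_assoc] at hgw
    exact List.append_cancel_left hgw
  obtain ⟨p, hp, h0, hle⟩ := exists_suffix_le fs (List.pairwise_cons.1 hfP).1 t ht
    ⟨_, heq⟩
  have hpg : p <:+ f ++ t := hp.trans (List.suffix_append _ _)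
  by_cases e : p = f ++ t
  · have h1 := hp.length_le
    rw [e, List.length_append] at h1
    have hf0 : f = [] := List.length_eq_zero_iff.1 (by omega)
    subst hf0
    have : p ≤ [] := hle
    rw [← not_lt] at this
    cases p with
    | nil => exact h0 rfl
    | cons a p => exact this (by simp)
  · exact absurd ((hgL _ (by simp)).2 p hpg h0 e) (not_lt.2 (hle.trans hfg))

theorem IsLyndonFactorization.unique {w : List α} {fs gs : List (List α)}
    (hf : IsLyndonFactorization w fs) (hg : IsLyndonFactorization w gs) : fs = gs := by
  induction fs generalizing w gs with
  | nil =>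
    cases gs with
    | nil => rfl
    | cons g gs =>
      have h := hf.1.trans hg.1.symm
      simp only [List.flatten_nil, List.flatten_cons] at h
      exact absurd (List.append_eq_nil_iff.1 h.symm).1 (hg.2.1 g (by simp)).1
  | cons f fs ih =>
    cases gs with
    | nil =>
      have h := hg.1.trans hf.1.symm
      simp only [List.flatten_nil, List.flatten_cons] at h
      exact absurd (List.append_eq_nil_iff.1 h.symm).1 (hf.2.1 f (by simp)).1
    | cons g gs =>
      have hlen : f.length = g.length := le_antisymm
        (isLyndonFactorization_length_le hg hf) (isLyndonFactorization_length_le hf hg)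
      have h := hf.1.trans hg.1.symm
      rw [List.flatten_cons, List.flatten_cons] at h
      obtain rfl := List.append_inj_left h hlen
      rw [ih (w := fs.flatten) (gs := gs)
        ⟨rfl, fun k hk => hf.2.1 k (by simp [hk]), (List.pairwise_cons.1 hf.2.2).2⟩
        ⟨List.append_cancel_left h.symm, fun k hk => hg.2.1 k (by simp [hk]), (List.pairwise_cons.1 hg.2.2).2⟩]

/-- The Lyndon factorization of `w`: the unique decomposition of `w` into a lexicographically
non-increasing sequence of Lyndon words. -/
noncomputable def lyndonFactorization (w : List α) : List (List α) :=
  (exists_isLyndonFactorization w).choose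

theorem lyndonFactorization_spec (w : List α) :
    IsLyndonFactorization w (lyndonFactorization w) :=
  (exists_isLyndonFactorization w).choose_spec

/-! ### The bijective Burrows--Wheeler transform -/

/-- The symbol at position `i` (counted from `0`) of the infinite string `x^∞ = x x x ⋯`; it is
`none` only for the empty string `x`. -/
def infPow {β : Type*} (x : List β) (i : ℕ) : Option β := x[i % x.length]?

/-- The strict `ω`-order: `x^∞` is lexicographically smaller than `y^∞`, that is, at the first
position where they differ, the symbol of `x^∞` is the smaller one. (On `Option α`, `none` lies
below all symbols; this only concerns the empty string, which is never a Lyndon factor.) -/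
def OmegaLT (x y : List α) : Prop :=
  ∃ k, (∀ i < k, infPow x i = infPow y i) ∧ infPow x k < infPow y k

/-- The non-strict `ω`-order. -/
def OmegaLE (x y : List α) : Prop :=
  infPow x = infPow y ∨ OmegaLT x y

open Classical in
/-- All cyclic rotations of all Lyndon factors of `w` (with multiplicity, `w.length` strings in
total), sorted in `ω`-order. -/
noncomputable def sortedRotations (w : List α) : List (List α) :=
  ((lyndonFactorization w).flatMap List.cyclicPermutations).mergeSort
    (fun x y => decide (OmegaLE x y))

/-- The bijective Burrows--Wheeler transform: the concatenation of the last symbols of all cyclic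
rotations of all Lyndon factors of `w`, taken in `ω`-order. -/
noncomputable def bbwt (w : List α) : List α :=
  (sortedRotations w).filterMap List.getLast?

open Classical in
/-- The number of maximal runs of equal symbols in `x`. A run is counted at its first position,
that is, at a position `i` that is the first one or carries a symbol other than that of `i - 1`. -/
noncomputable def numRuns {β : Type*} (x : List β) : ℕ :=
  ((Finset.range x.length).filter (fun i => i = 0 ∨ x[i - 1]? ≠ x[i]?)).card

/-- `r_B(w)`: the number of maximal same-character runs of the bijective Burrows--Wheeler
transform of `w`. -/
noncomputable def rB (w : List α) : ℕ := numRuns (bbwt w)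

/-! ### The LZ77 factorization -/

/-- The substring of `w` of length `len` at position `i` (counted from `0`) also occurs in `w` at
an earlier position; the two occurrences may overlap. -/
def HasEarlierOcc {β : Type*} (w : List β) (i len : ℕ) : Prop :=
  ∃ j < i, (w.drop j).take len = (w.drop i).take len

open Classical in
/-- The length of the LZ77 factor of `w` that starts at position `i`: the factor is the longest
prefix of the rest of `w` with an earlier occurrence in `w`, or a single symbol if that prefix is
empty (a symbol that occurs for the first time). -/
noncomputable def lzFactorLength {β : Type*} (w : List β) (i : ℕ) : ℕ :=
  max 1 (Nat.findGreatest (HasEarlierOcc w i) (w.length - i))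

/-- The LZ77 factors of the part of `w` that starts at position `i`, computed greedily from left
to right. -/
noncomputable def lzFactorsFrom {β : Type*} (w : List β) (i : ℕ) : List (List β) :=
  if i < w.length then
    (w.drop i).take (lzFactorLength w i) :: lzFactorsFrom w (i + lzFactorLength w i)
  else []
termination_by w.length - i
decreasing_by
  have : 1 ≤ lzFactorLength w i := le_max_left _ _
  omega

/-- The (greedy, overlapping) LZ77 factorization of `w`. -/
noncomputable def lz77 {β : Type*} (w : List β) : List (List β) := lzFactorsFrom w 0

end Strings

/-!
The number of runs of the transform is one more than the number of `ω`-adjacent rotations with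
different last symbols. Extend every rotation `x` to the bi-infinite periodic string with period
`x`; the last symbol of `x` is then the symbol at position `-1`, and the family of these strings is
invariant under the shift, because all rotations of a factor are present.

*Windows.* For each `m > 0` there are at most `3zm` different windows of length `m` in these strings
(`card_windows_rotationPow_le`). A window that occurs in `w` has a leftmost occurrence, which
reaches the end of the LZ77 phrase in which it starts; so there are at most `zm` of these. A window
of `f^∞`, for a Lyndon factor `f`, may fail to occur in `w` only if it crosses the end of `f` and if
the suffixes `s` and `s'` of `w` before and after `f` differ within `m` symbols. As `s` is the least
of the suffixes that start before the end of `f`, and `s' ≤ s`, the prefix of `s'` of length `m` has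
then no earlier occurrence, so that a phrase ends within the next `m` positions. Hence the window
starts at one of `2m` positions before a phrase end (`window_mem_or`).

*Charging.* Consider adjacent strings with different left symbols `a ≠ b` and a longest common
prefix `u` of length in `[l, 2l)`. For each prefix `u'` of `u` of length less than `l`, one of `a
u'` and `b u'` occurs at most half as often as `u'`. Charge the pair to the window of length `3l`,
on the corresponding side, that has the end of `u'` at position `l`. The side, the window and the
length of `u'` determine the pair, and in a fixed window the halving happens at most `log₂ n`
times. So `l` charges per pair and `9zl` windows leave room for `O(z log n)` pairs
(`card_isBoundary_le`). Two of the strings that agree on `n²` symbols are equal, as the product of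
their periods is a period of both; therefore `O(log n)` dyadic ranges for the length of `u`
suffice (`card_ne_le`).
-/

namespace Strings

/-! ### Adjacent strings with a common prefix of prescribed length -/

/-- Along `a` steps, an antitone sequence of naturals can drop to at most a half of its value only
logarithmically often. -/
theorem two_pow_card_halving_mul_le {M : ℕ → ℕ} (hM : Antitone M) (a : ℕ) :
    2 ^ ((Finset.range a).filter fun k => 2 * M (k + 1) ≤ M k).card * M a ≤ M 0 := by
  induction a with
  | zero => simp
  | succ a ih =>
    rw [Finset.range_add_one, Finset.filter_insert]
    split_ifs with h
    · rw [Finset.card_insert_of_notMem (by simp), pow_succ, mul_assoc]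
      exact (Nat.mul_le_mul_left _ h).trans ih
    · exact (Nat.mul_le_mul_left _ (hM (Nat.le_succ a))).trans ih

theorem apply_zpow_of_shift {ι A : Type*} {F : ι → ℤ → A} {σ : Equiv.Perm ι}
    (hσ : ∀ i x, F (σ i) x = F i (x + 1)) (z : ℤ) (i : ι) (x : ℤ) :
    F ((σ ^ z) i) x = F i (x + z) := by
  induction z generalizing i x with
  | zero => simp
  | succ k ih =>
    rw [zpow_add_one, Equiv.Perm.mul_apply, ih, hσ]; congr 1; ring
  | pred k ih =>
    rw [zpow_sub_one, Equiv.Perm.mul_apply, ih]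
    have := hσ (σ⁻¹ i) (x + -k - 1)
    rw [← Equiv.Perm.mul_apply, mul_inv_cancel, Equiv.Perm.one_apply] at this
    rw [show x + (-(k : ℤ) - 1) = x + -k - 1 by ring]
    rw [this]; congr 1; ring

open Classical in
/-- The set of the windows of length `m` of a family of bi-infinite strings. By shift invariance of
the families considered here, it is enough to take the windows at position `0`. -/
noncomputable def windows {ι A : Type*} [Fintype ι] (F : ι → ℤ → A) (m : ℕ) :
    Finset (Fin m → A) :=
  Finset.univ.image fun i x => F i (x : ℤ)

/-- The lexicographically adjacent strings of a sorted family whose left symbols differ and whose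
longest common prefix has length in `[a, 2a)`. -/
def IsBoundary {A : Type*} {n : ℕ} (F : Fin (n + 1) → ℤ → A) (a : ℕ) (i : Fin n) : Prop :=
  F i.castSucc (-1) ≠ F i.succ (-1) ∧ (∀ x : ℕ, x < a → F i.castSucc x = F i.succ x) ∧
    ∃ x : ℕ, x < 2 * a ∧ F i.castSucc x ≠ F i.succ x

/-- In a family enumerated in lexicographic order, a string between two strings with a common
prefix of length `m` has this prefix, too. This is all that is used of the order. -/
def PrefixConvex {A : Type*} {n : ℕ} (F : Fin n → ℤ → A) : Prop :=
  ∀ (m : ℕ) (i j k : Fin n), i ≤ j → j ≤ k → (∀ x : ℕ, x < m → F i x = F k x) →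
    ∀ x : ℕ, x < m → F i x = F j x

/-- Two different positions at which the sorted family splits within its first `m` symbols are
separated by their prefixes of length `m`, on either side of the split. -/
theorem PrefixConvex.eq_of_agree {A : Type*} {n m : ℕ} {F : Fin (n + 1) → ℤ → A}
    (hF : PrefixConvex F) {i j : Fin n}
    (hi : ∃ x : ℕ, x < m ∧ F i.castSucc x ≠ F i.succ x)
    (hj : ∃ x : ℕ, x < m ∧ F j.castSucc x ≠ F j.succ x)
    (h : (∀ x : ℕ, x < m → F i.castSucc x = F j.castSucc x) ∨
      (∀ x : ℕ, x < m → F i.succ x = F j.succ x)) : i = j := by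
  wlog hij : i < j generalizing i j
  · rcases lt_or_eq_of_le (not_lt.1 hij) with h1 | h1
    · refine (this hj hi (h.imp ?_ ?_) h1).symm <;> exact fun h x hx => (h x hx).symm
    · exact h1.symm
  exfalso
  rcases h with h | h
  · obtain ⟨x, hx, hne⟩ := hi
    exact hne (hF m i.castSucc i.succ j.castSucc (Fin.castSucc_lt_succ).le
      (Fin.succ_le_castSucc_iff.2 hij) h x hx)
  · obtain ⟨x, hx, hne⟩ := hj
    have h1 := hF m i.succ j.castSucc j.succ (Fin.succ_le_castSucc_iff.2 hij)
      (Fin.castSucc_lt_succ).le h x hx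
    exact hne (h1.symm.trans (h x hx))

section Light

variable {A : Type*} {n : ℕ} (F : Fin (n + 1) → ℤ → A)

open Classical in
/-- The number of strings of the family that carry the last `k` symbols before position `a` of the
window `s` at the same positions. -/
noncomputable def numMatches {m : ℕ} (a : ℕ) (s : Fin m → A) (k : ℕ) : ℕ :=
  (Finset.univ.filter fun i => ∀ x : Fin m, a ≤ x + k → (x : ℕ) < a → F i (x : ℤ) = s x).card

theorem antitone_numMatches {m : ℕ} (a : ℕ) (s : Fin m → A) : Antitone (numMatches F a s) := by
  intro k l hkl
  unfold numMatches
  refine Finset.card_le_card fun i hi => ?_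
  simp only [Finset.mem_filter, Finset.mem_univ, true_and] at hi ⊢
  exact fun x h1 h2 => hi x (by omega) h2

open Classical in
theorem card_light_le {m a : ℕ} {s : Fin m → A} (hs : s ∈ windows F m) :
    ((Finset.range a).filter fun k =>
      2 * numMatches F a s (k + 1) ≤ numMatches F a s k).card ≤ Nat.log 2 (n + 1) := by
  have h := two_pow_card_halving_mul_le (antitone_numMatches F a s) a
  have h0 : numMatches F a s 0 ≤ n + 1 := by
    unfold numMatches
    exact (Finset.card_le_univ _).trans (by simp)
  have h1 : 1 ≤ numMatches F a s a := by
    simp only [windows, Finset.mem_image, Finset.mem_univ, true_and] at hs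
    obtain ⟨i, rfl⟩ := hs
    unfold numMatches
    exact Finset.card_pos.2 ⟨i, by simp⟩
  refine Nat.le_log_of_pow_le (by norm_num) ((Nat.le_mul_of_pos_right _ h1).trans (h.trans h0))

/-- By shift invariance, the strings that match the last `l` symbols before position `a` of a window
of `F b` are as many as those that agree with `F b` at the original place `[k - l, k)` of these
symbols; the window is the one that has position `k` of `F b` at its position `a`. -/
theorem numMatches_shift {σ : Equiv.Perm (Fin (n + 1))} (hσ : ∀ i x, F (σ i) x = F i (x + 1))
    {m a : ℕ} (ha : a ≤ m) (b : Fin (n + 1)) (k l : ℕ) (hl : l ≤ a) :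
    numMatches F a (fun x : Fin m => F b (x + k - a)) l =
      Nat.card {i // ∀ x : ℤ, k - l ≤ x → x < k → F i x = F b x} := by
  classical
  rw [Nat.card_eq_fintype_card, Fintype.card_subtype]
  unfold numMatches
  refine Finset.card_equiv (σ ^ ((a : ℤ) - k)) fun i => ?_
  simp only [Finset.mem_filter, Finset.mem_univ, true_and, apply_zpow_of_shift hσ]
  constructor
  · intro h x h1 h2
    have := h ⟨(x + a - k).toNat, by omega⟩ (by simp only; omega) (by simp only; omega)
    simp only at this
    rw [show (((x + a - k).toNat : ℕ) : ℤ) = x + a - k by omega] at this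
    rw [show x + ((a : ℤ) - k) = x + a - k by ring, this]
    congr 1; ring
  · intro h x h1 h2
    have := h (x + k - a) (by omega) (by omega)
    rw [← this]
    congr 1; ring

end Light

open Classical in
/-- If the windows of length `m` number at most `K * m`, then at most `O(K log n)` adjacent strings
with different left symbols have a longest common prefix of length in `[a, 2a)`.

For such a pair and each `k < a`, prepending its left symbol to the common prefix of length `k`
at least halves the number of occurrences on one of the two sides. The pair is charged to the
window of length `3a` on that side which has the end of this prefix at position `a`. The window and
`k` determine the first `2a` symbols on that side, hence the pair; and in one window only
logarithmically many `k` have the halving property. -/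
theorem card_isBoundary_le {A : Type*} {n : ℕ} {F : Fin (n + 1) → ℤ → A}
    {σ : Equiv.Perm (Fin (n + 1))} (hσ : ∀ i x, F (σ i) x = F i (x + 1)) (hF : PrefixConvex F)
    {K : ℕ} (hK : ∀ m, 0 < m → (windows F m).card ≤ K * m) {a : ℕ} (ha : 0 < a) :
    (Finset.univ.filter (IsBoundary F a)).card ≤ 6 * K * Nat.log 2 (n + 1) := by
  set B := Finset.univ.filter (IsBoundary F a) with hB
  let occ : Fin (n + 1) → ℤ → ℤ → ℕ := fun b l k =>
    Nat.card {i // ∀ x : ℤ, l ≤ x → x < k → F i x = F b x}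
  let side : Bool → Fin n → Fin (n + 1) := fun t i => if t then i.succ else i.castSucc
  -- The occurrences of the two left extensions of a common prefix are disjoint sets of occurrences
  -- of this prefix, so that one of them has at most half the size.
  have hlight : ∀ i ∈ B, ∀ k < a, ∃ t, 2 * occ (side t i) (-1) k ≤ occ (side t i) 0 k := by
    intro i hi k hk
    simp only [hB, Finset.mem_filter, Finset.mem_univ, true_and] at hi
    obtain ⟨h1, h2, -⟩ := hi
    have h2' : ∀ x : ℤ, 0 ≤ x → x < k → F i.castSucc x = F i.succ x := by
      intro x hx hxk
      have := h2 x.toNat (by omega)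
      rwa [Int.toNat_of_nonneg hx] at this
    have hsum : occ i.castSucc (-1) k + occ i.succ (-1) k ≤ occ i.castSucc 0 k := by
      simp only [occ, Nat.card_eq_fintype_card, Fintype.card_subtype]
      rw [← Finset.card_union_of_disjoint]
      · refine Finset.card_le_card fun j hj => ?_
        simp only [Finset.mem_union, Finset.mem_filter, Finset.mem_univ, true_and] at hj ⊢
        rcases hj with hj | hj
        · exact fun x h0 h1 => hj x (by omega) h1
        · exact fun x h0 h1 => (hj x (by omega) h1).trans (h2' x h0 h1).symm
      · rw [Finset.disjoint_left]
        intro j hj hj'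
        simp only [Finset.mem_filter, Finset.mem_univ, true_and] at hj hj'
        exact h1 ((hj (-1) le_rfl (by omega)).symm.trans (hj' (-1) le_rfl (by omega)))
    have heq : occ i.succ 0 k = occ i.castSucc 0 k := by
      simp only [occ, Nat.card_eq_fintype_card, Fintype.card_subtype]
      congr 1
      refine Finset.filter_congr fun j _ => ?_
      refine forall_congr' fun x => ?_
      refine forall_congr' fun h0 => forall_congr' fun hk => ?_
      rw [h2' x h0 hk]
    by_cases h : 2 * occ i.castSucc (-1) k ≤ occ i.castSucc 0 k
    · exact ⟨false, h⟩
    · refine ⟨true, ?_⟩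
      simp only [side, if_true]
      omega
  choose! t ht using hlight
  let win : Fin n → ℕ → Fin (3 * a) → A := fun i k x => F (side (t i k) i) (x + k - a)
  let T : Finset (Σ _ : Bool × (Fin (3 * a) → A), ℕ) :=
    (Finset.univ ×ˢ windows F (3 * a)).sigma fun p => (Finset.range a).filter fun k =>
      2 * numMatches F a p.2 (k + 1) ≤ numMatches F a p.2 k
  have hT : T.card ≤ 2 * (K * (3 * a)) * Nat.log 2 (n + 1) := by
    rw [Finset.card_sigma]
    refine (Finset.sum_le_card_nsmul _ _ (Nat.log 2 (n + 1)) fun p hp => ?_).trans ?_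
    · exact card_light_le F (Finset.mem_product.1 hp).2
    · rw [smul_eq_mul, Finset.card_product]
      refine Nat.mul_le_mul_right _ ?_
      simpa using hK (3 * a) (by omega)
  have hle : (B ×ˢ Finset.range a).card ≤ T.card := by
    refine Finset.card_le_card_of_injOn
      (fun p => ⟨(t p.1 p.2, win p.1 p.2), p.2⟩) ?_ ?_
    · rintro ⟨i, k⟩ hp
      simp only [Finset.coe_product, Set.mem_prod, Finset.mem_coe, Finset.mem_range] at hp
      simp only [T, Finset.mem_coe, Finset.mem_sigma, Finset.mem_product, Finset.mem_univ,
        true_and, Finset.mem_filter, Finset.mem_range]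
      refine ⟨?_, hp.2, ?_⟩
      · simp only [windows, Finset.mem_image, Finset.mem_univ, true_and]
        refine ⟨(σ ^ ((k : ℤ) - a)) (side (t i k) i), funext fun x => ?_⟩
        rw [apply_zpow_of_shift hσ]
        simp only [win]
        congr 1; ring
      · have := ht i hp.1 k hp.2
        simp only [win]
        rw [numMatches_shift F hσ (by omega) _ _ _ (by omega),
          numMatches_shift F hσ (by omega) _ _ _ (by omega)]
        simpa [occ] using this
    · rintro ⟨i, k⟩ hp ⟨j, l⟩ hq h
      simp only [Finset.coe_product, Set.mem_prod, Finset.mem_coe, Finset.mem_range, hB,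
        Finset.mem_filter, Finset.mem_univ, true_and] at hp hq
      simp only [Sigma.mk.injEq, Prod.mk.injEq, heq_eq_eq] at h
      obtain ⟨⟨h1, h2⟩, rfl⟩ := h
      have hag : ∀ x : ℕ, x < 2 * a → F (side (t i k) i) x = F (side (t i k) j) x := by
        intro x hx
        have := congrFun h2 ⟨x + a - k, by omega⟩
        simp only [win, ← h1] at this
        rwa [show ((x + a - k : ℕ) : ℤ) + k - a = x by omega] at this
      have : i = j := by
        refine hF.eq_of_agree hp.1.2.2 hq.1.2.2 ?_
        cases hs : t i k
        · left; simpa [hs, side] using hag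
        · right; simpa [hs, side] using hag
      rw [this]
  -- Each pair makes `a` charges.
  rw [Finset.card_product, Finset.card_range] at hle
  refine Nat.le_of_mul_le_mul_right ?_ ha
  calc B.card * a ≤ 2 * (K * (3 * a)) * Nat.log 2 (n + 1) := hle.trans hT
    _ = 6 * K * Nat.log 2 (n + 1) * a := by ring

open Classical in
/-- Summation of `card_isBoundary_le` over the powers of two below a bound for the longest common
prefixes, and over the adjacent pairs without a common prefix. -/
theorem card_ne_le {A : Type*} {n : ℕ} {F : Fin (n + 1) → ℤ → A}
    {σ : Equiv.Perm (Fin (n + 1))} (hσ : ∀ i x, F (σ i) x = F i (x + 1)) (hF : PrefixConvex F)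
    {K : ℕ} (hK : ∀ m, 0 < m → (windows F m).card ≤ K * m) {d : ℕ}
    (hd : ∀ i j, (∀ x : ℕ, x < 2 ^ d → F i x = F j x) → F i = F j) :
    (Finset.univ.filter fun i : Fin n => F i.castSucc (-1) ≠ F i.succ (-1)).card ≤
      K + d * (6 * K * Nat.log 2 (n + 1)) := by
  set Z := Finset.univ.filter fun i : Fin n => F i.castSucc 0 ≠ F i.succ 0 with hZ
  have hZc : Z.card ≤ K := by
    refine le_trans ?_ ((hK 1 one_pos).trans (by simp))
    refine Finset.card_le_card_of_injOn (fun i x => F i.succ (x : ℕ)) ?_ ?_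
    · intro i _
      simp only [windows, Finset.coe_image, Finset.coe_univ, Set.image_univ]
      exact ⟨i.succ, rfl⟩
    · intro i hi j hj h
      simp only [hZ, Finset.coe_filter, Finset.mem_univ, true_and, Set.mem_ofPred_eq] at hi hj
      refine hF.eq_of_agree (m := 1) ⟨0, by simp, by simpa using hi⟩ ⟨0, by simp, by simpa using hj⟩
        (Or.inr fun x hx => ?_)
      exact congrFun h ⟨x, hx⟩
  have hsub : (Finset.univ.filter fun i : Fin n => F i.castSucc (-1) ≠ F i.succ (-1)) ⊆
      Z ∪ (Finset.range d).biUnion fun j => Finset.univ.filter (IsBoundary F (2 ^ j)) := by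
    intro i hi
    simp only [Finset.mem_filter, Finset.mem_univ, true_and] at hi
    have hex : ∃ x : ℕ, F i.castSucc x ≠ F i.succ x := by
      by_contra! h
      exact hi (congrFun (hd _ _ fun x _ => h x) _)
    have hlt : Nat.find hex < 2 ^ d := by
      by_contra! h
      refine hi (congrFun (hd _ _ fun x hx => ?_) _)
      exact not_not.1 (Nat.find_min hex (hx.trans_le h))
    have hspec := Nat.find_spec hex
    have hmin : ∀ x : ℕ, x < Nat.find hex → F i.castSucc x = F i.succ x := fun x hx =>
      not_not.1 (Nat.find_min hex hx)
    generalize Nat.find hex = l at hlt hspec hmin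
    rw [Finset.mem_union]
    rcases Nat.eq_zero_or_pos l with rfl | hl
    · left; simpa [hZ] using hspec
    · right
      simp only [Finset.mem_biUnion, Finset.mem_range, Finset.mem_filter, Finset.mem_univ, true_and]
      refine ⟨Nat.log 2 l, Nat.log_lt_of_lt_pow (by omega) hlt, hi, fun x hx => hmin x ?_, l, ?_,
        hspec⟩
      · exact hx.trans_le (Nat.pow_log_le_self 2 (by omega))
      · have := Nat.lt_pow_succ_log_self (b := 2) (by norm_num) l
        rwa [pow_succ, mul_comm] at this
  refine (Finset.card_le_card hsub).trans ((Finset.card_union_le _ _).trans ?_)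
  refine add_le_add hZc (Finset.card_biUnion_le.trans ?_)
  refine (Finset.sum_le_card_nsmul _ _ _ fun j _ =>
    card_isBoundary_le hσ hF hK (pow_pos two_pos j)).trans ?_
  simp

/-! ### Phrase ends of the LZ77 factorization -/

theorem one_le_lzFactorLength {β : Type*} (w : List β) (i : ℕ) : 1 ≤ lzFactorLength w i :=
  le_max_left _ _

theorem add_lzFactorLength_le {β : Type*} (w : List β) {i : ℕ} (hi : i < w.length) :
    i + lzFactorLength w i ≤ w.length := by
  classical
  unfold lzFactorLength
  have := Nat.findGreatest_le (P := HasEarlierOcc w i) (w.length - i)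
  omega

/-- A factor of length at least two has an earlier occurrence; hence so has every substring that
starts in it and ends before its end. -/
theorem exists_lt_of_lt_lzFactorLength {β : Type*} {w : List β} {i d m : ℕ} (hm : 0 < m)
    (h : d + m ≤ lzFactorLength w i) (h2 : 2 ≤ lzFactorLength w i) :
    ∃ j < i + d, (w.drop j).take m = (w.drop (i + d)).take m := by
  classical
  have h1 : Nat.findGreatest (HasEarlierOcc w i) (w.length - i) = lzFactorLength w i := by
    unfold lzFactorLength at h2 ⊢
    omega
  have h3 := Nat.findGreatest_of_ne_zero h1 (by omega)
  obtain ⟨j, hj, he⟩ := h3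
  refine ⟨j + d, by omega, ?_⟩
  have := congrArg (fun l => (l.drop d).take m) he
  simpa [List.drop_take, List.take_take, min_eq_left (show m ≤ lzFactorLength w i - d by omega)]
    using this

/-- The witness `E` is the set of the ends of the phrases from position `i` on: a substring at its
leftmost occurrence reaches the end of the phrase in which it starts. -/
theorem exists_phraseEnds_from {β : Type*} (w : List β) (i : ℕ) :
    ∃ E : Finset ℕ, E.card ≤ (lzFactorsFrom w i).length ∧ (i < w.length → w.length ∈ E) ∧
      ∀ b m, i ≤ b → b < w.length → 0 < m →
        (∀ j < b, (w.drop j).take m ≠ (w.drop b).take m) → ∃ e ∈ E, b < e ∧ e ≤ b + m := by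
  induction i using lzFactorsFrom.induct (w := w) with
  | case1 i hi ih =>
    obtain ⟨E, h1, h2, h3⟩ := ih
    have hl1 := one_le_lzFactorLength w i
    have hl2 := add_lzFactorLength_le w hi
    refine ⟨insert (i + lzFactorLength w i) E, ?_, fun _ => ?_, fun b m hib hb hm hocc => ?_⟩
    · rw [lzFactorsFrom, if_pos hi, List.length_cons]
      exact (Finset.card_insert_le _ _).trans (Nat.succ_le_succ h1)
    · rw [Finset.mem_insert]
      rcases hl2.eq_or_lt with h | h
      · exact Or.inl h.symm
      · exact Or.inr (h2 h)
    · rcases le_or_gt (i + lzFactorLength w i) b with h | h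
      · obtain ⟨e, he, h4⟩ := h3 b m h hb hm hocc
        exact ⟨e, Finset.mem_insert_of_mem he, h4⟩
      · refine ⟨_, Finset.mem_insert_self _ _, h, ?_⟩
        by_contra! hlt
        obtain ⟨j, hj, he⟩ := exists_lt_of_lt_lzFactorLength (w := w) (i := i) (d := b - i) hm
          (by omega) (by omega)
        rw [Nat.add_sub_cancel' hib] at hj he
        exact hocc j hj he
  | case2 i hi =>
    exact ⟨∅, by simp, fun h => absurd h hi, fun b m hib hb => by omega⟩

theorem exists_phraseEnds {β : Type*} (w : List β) :
    ∃ E : Finset ℕ, E.card ≤ (lz77 w).length ∧ (0 < w.length → w.length ∈ E) ∧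
      ∀ b m, b < w.length → 0 < m →
        (∀ j < b, (w.drop j).take m ≠ (w.drop b).take m) → ∃ e ∈ E, b < e ∧ e ≤ b + m := by
  obtain ⟨E, h1, h2, h3⟩ := exists_phraseEnds_from w 0
  exact ⟨E, h1, h2, fun b m => h3 b m (Nat.zero_le b)⟩

/-! ### Suffixes of a word and its Lyndon factorization -/

section Lyndon

variable {α : Type*} [LinearOrder α]

theorem take_le_take (m : ℕ) {a b : List α} (h : a ≤ b) : a.take m ≤ b.take m := by
  by_contra! hlt
  refine absurd h (not_le.2 ?_)
  by_cases hp : b.take m <+: a.take m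
  · have hlen : b.length ≤ m := by
      by_contra! hb
      refine hlt.ne (hp.eq_of_length_le ?_)
      simp only [List.length_take]; omega
    rw [List.take_of_length_le hlen] at hp hlt
    refine lt_of_le_of_ne (le_of_isPrefix (hp.trans (List.take_prefix m a))) ?_
    rintro rfl
    exact not_le.2 hlt (le_of_isPrefix (List.take_prefix m _))
  · have := append_lt_append_of_lt hlt hp (b.drop m) (a.drop m)
    simpa using this

theorem append_le_append_left (s : List α) {a b : List α} (h : a ≤ b) : s ++ a ≤ s ++ b := by
  rcases h.lt_or_eq with h | rfl
  · exact (append_lt_append_left s h).le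
  · exact le_rfl

/-- Words that are at most a Lyndon word `f` cannot beat a proper suffix of `f`, even after
concatenation. -/
theorem IsLyndon.flatten_le_suffix_append {f : List α} (hf : IsLyndon f) (gs : List (List α))
    (hgs : ∀ g ∈ gs, g ≤ f) {v : List α} (hv : v <:+ f) (h0 : v ≠ []) (h1 : v ≠ f)
    (r : List α) : gs.flatten ≤ v ++ r := by
  induction gs generalizing v with
  | nil => exact le_of_isPrefix List.nil_prefix
  | cons h gs ih =>
    have hlt : h < v := (hgs h (by simp)).trans_lt (hf.2 v hv h0 h1)
    rw [List.flatten_cons]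
    by_cases hp : h <+: v
    · obtain ⟨v', rfl⟩ := hp
      rw [List.append_assoc]
      have hv' : v' <:+ f := (List.suffix_append h v').trans hv
      refine append_le_append_left h (ih (fun g hg => hgs g (by simp [hg])) hv' ?_ ?_)
      · rintro rfl
        simp at hlt
      · rintro rfl
        have := hv.length_le
        rw [List.length_append] at this
        have hh : h = [] := List.length_eq_zero_iff.1 (by omega)
        exact h1 (by simp [hh])
    · exact (append_lt_append_of_lt hlt hp _ _).le

theorem IsLyndon.flatten_le_append_flatten {f : List α} (hf : IsLyndon f) (gs : List (List α))
    (hgs : ∀ g ∈ gs, g ≤ f) : gs.flatten ≤ f ++ gs.flatten := by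
  induction gs with
  | nil => exact le_of_isPrefix List.nil_prefix
  | cons h gs ih =>
    have ih := ih fun g hg => hgs g (by simp [hg])
    rw [List.flatten_cons]
    rcases (hgs h (by simp)).lt_or_eq with hlt | rfl
    · by_cases hp : h <+: f
      · obtain ⟨v, rfl⟩ := hp
        rw [List.append_assoc]
        refine append_le_append_left h ?_
        by_cases h0 : h = []
        · subst h0
          simpa using ih
        · refine hf.flatten_le_suffix_append gs (fun g hg => hgs g (by simp [hg]))
            (List.suffix_append h v) ?_ (by simpa using h0) _
          rintro rfl
          simp at hlt
      · exact (append_lt_append_of_lt hlt hp _ _).le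
    · exact append_le_append_left h ih

theorem IsLyndon.append_le_drop_append {f : List α} (hf : IsLyndon f) {j : ℕ} (hj : j < f.length)
    (r : List α) : f ++ r ≤ f.drop j ++ r := by
  rcases Nat.eq_zero_or_pos j with rfl | h0
  · simp
  · have hlen : (f.drop j).length < f.length := by rw [List.length_drop]; omega
    have hne : f.drop j ≠ f := fun e => by rw [e] at hlen; omega
    have hlt := hf.2 (f.drop j) (List.drop_suffix j f)
      (fun e => by have := congrArg List.length e; simp at this; omega) hne
    exact (append_lt_append_of_lt hlt (fun hp => by have := hp.length_le; omega) _ _).le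

/-- The suffix that starts with a Lyndon factor is the least among the suffixes that start before
the end of this factor. -/
theorem flatten_cons_le_drop {w f : List α} {l₁ l₂ : List (List α)}
    (hw : IsLyndonFactorization w (l₁ ++ f :: l₂)) {j : ℕ}
    (hj : j < l₁.flatten.length + f.length) : f ++ l₂.flatten ≤ w.drop j := by
  obtain ⟨rfl, hL, hP⟩ := hw
  induction l₁ generalizing j with
  | nil =>
    simp only [List.nil_append, List.flatten_nil, List.length_nil, Nat.zero_add,
      List.flatten_cons] at hj ⊢
    rw [List.drop_append_of_le_length hj.le]
    exact (hL f (by simp)).append_le_drop_append hj _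
  | cons g l₁ ih =>
    rw [List.cons_append, List.pairwise_cons] at hP
    have ih : ∀ {j}, j < l₁.flatten.length + f.length →
        f ++ l₂.flatten ≤ (l₁ ++ f :: l₂).flatten.drop j := fun {j} hj =>
      @ih j hj (fun x hx => hL x (List.mem_cons_of_mem g hx)) hP.2
    have hg : IsLyndon g := hL g (by simp)
    simp only [List.flatten_cons, List.cons_append, List.length_append] at hj ⊢
    rcases lt_or_ge j g.length with h | h
    · rw [List.drop_append_of_le_length h.le]
      refine le_trans ?_ (hg.append_le_drop_append h _)
      refine le_trans ?_ (hg.flatten_le_append_flatten _ hP.1)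
      have hf : 0 < f.length := List.length_pos_iff.2 (hL f (by simp)).1
      simpa using ih (j := 0) (by omega)
    · have := ih (j := j - g.length) (by omega)
      rwa [List.drop_append, List.drop_eq_nil_of_le h, List.nil_append]

/-- If the suffixes before and after a Lyndon factor differ within the first `m` symbols, then the
prefix of length `m` of the latter suffix occurs there for the first time. -/
theorem take_drop_ne_of_take_ne {w f : List α} {l₁ l₂ : List (List α)}
    (hw : IsLyndonFactorization w (l₁ ++ f :: l₂)) {m : ℕ}
    (hne : (f ++ l₂.flatten).take m ≠ l₂.flatten.take m) {j : ℕ}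
    (hj : j < l₁.flatten.length + f.length) : (w.drop j).take m ≠ l₂.flatten.take m := by
  intro h
  have h1 := take_le_take m (flatten_cons_le_drop hw hj)
  have hP := (List.pairwise_append.1 hw.2.2).2.1
  rw [List.pairwise_cons] at hP
  have h2 := take_le_take m
    ((hw.2.1 f (by simp)).flatten_le_append_flatten l₂ hP.1)
  exact hne (le_antisymm (h1.trans h.le) h2)

/-- If the suffixes before and after a Lyndon factor `f` agree on the first `m` symbols, then the
former suffix agrees with `f^∞` on the first `|f| + m` symbols. -/
theorem getElem?_append_eq_infPow {β : Type*} {f s : List β} (hf : f ≠ []) {m : ℕ}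
    (h : (f ++ s).take m = s.take m) {x : ℕ} (hx : x < f.length + m) :
    (f ++ s)[x]? = infPow f x := by
  have hl : 0 < f.length := List.length_pos_iff.2 hf
  induction x using Nat.strong_induction_on with
  | _ x ih =>
    rcases lt_or_ge x f.length with h1 | h1
    · rw [infPow, Nat.mod_eq_of_lt h1, List.getElem?_append_left h1]
    · rw [List.getElem?_append_right h1]
      have h2 := congrArg (fun l => l[x - f.length]?) h
      simp only [List.getElem?_take_of_lt (show x - f.length < m by omega)] at h2
      rw [← h2, ih (x - f.length) (by omega) (by omega), infPow, infPow, Nat.mod_eq_sub_mod h1]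

/-! ### The substrings of the powers of the Lyndon factors -/

/-- A window of length `m` of the infinite power of a Lyndon factor occurs in `w`, unless it
starts at one of the `2m` positions before a phrase end. In the first case its leftmost occurrence
starts at one of the `m` positions before a phrase end. -/
theorem window_mem_or {w f : List α} {l₁ l₂ : List (List α)}
    (hw : IsLyndonFactorization w (l₁ ++ f :: l₂)) {E : Finset ℕ} (hE0 : w.length ∈ E)
    (hE : ∀ b m, b < w.length → 0 < m →
        (∀ j < b, (w.drop j).take m ≠ (w.drop b).take m) → ∃ e ∈ E, b < e ∧ e ≤ b + m)
    {m o : ℕ} (hm : 0 < m) (ho : o < f.length) :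
    (∃ e ∈ E, ∃ b, e ≤ b + m ∧ b < e ∧ ∀ x < m, infPow f (o + x) = w[b + x]?) ∨
      ∃ e ∈ E, e ≤ l₁.flatten.length + o + 2 * m ∧ l₁.flatten.length + o < e := by
  have hf := hw.2.1 f (by simp)
  have hwf : w = l₁.flatten ++ (f ++ l₂.flatten) := by
    rw [← hw.1]; simp
  have hlen : w.length = l₁.flatten.length + (f.length + l₂.flatten.length) := by
    rw [hwf]; simp
  -- A window that occurs in `w` is moved to its leftmost occurrence.
  have key : (∀ x < m, infPow f (o + x) = w[l₁.flatten.length + o + x]?) →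
      ∃ e ∈ E, ∃ b, e ≤ b + m ∧ b < e ∧ ∀ x < m, infPow f (o + x) = w[b + x]? := by
    intro h2
    have hex : ∃ b, (w.drop b).take m = (w.drop (l₁.flatten.length + o)).take m := ⟨_, rfl⟩
    classical
    have hb := Nat.find_spec hex
    have hble := Nat.find_le (h := hex) (n := l₁.flatten.length + o) rfl
    have hmin := fun j hj => Nat.find_min hex (m := j) hj
    generalize Nat.find hex = b at hb hble hmin
    obtain ⟨e, he, h3, h4⟩ := hE b m (by omega) hm fun j hj h => hmin j hj (h.trans hb)
    refine ⟨e, he, b, h4, h3, fun x hx => ?_⟩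
    rw [h2 x hx]
    have := congrArg (fun l => l[x]?) hb
    simpa [List.getElem?_take_of_lt hx] using this.symm
  by_cases hend : o + m ≤ f.length
  · refine Or.inl (key fun x hx => ?_)
    rw [hwf, Nat.add_assoc, List.getElem?_append_right (by omega), Nat.add_sub_cancel_left,
      List.getElem?_append_left (by omega), infPow, Nat.mod_eq_of_lt (by omega)]
  by_cases heq : (f ++ l₂.flatten).take m = l₂.flatten.take m
  · refine Or.inl (key fun x hx => ?_)
    rw [hwf, Nat.add_assoc, List.getElem?_append_right (by omega), Nat.add_sub_cancel_left,
      getElem?_append_eq_infPow hf.1 heq (by omega)]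
  · right
    rcases Nat.eq_zero_or_pos l₂.flatten.length with h0 | h0
    · exact ⟨_, hE0, by omega, by omega⟩
    · have hd : w.drop (l₁.flatten.length + f.length) = l₂.flatten := by
        rw [hwf, ← List.append_assoc, ← List.length_append, List.drop_left]
      obtain ⟨e, he, h3, h4⟩ := hE (l₁.flatten.length + f.length) m (by omega) hm fun j hj => by
        rw [hd]; exact take_drop_ne_of_take_ne hw heq hj
      exact ⟨e, he, by omega, by omega⟩

end Lyndon

open scoped List

/-! ### Bi-infinite powers and the `ω`-order -/

/-- The bi-infinite power of `x`: the two-sided periodic extension of `x^∞`. -/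
def biPow {β : Type*} (x : List β) (t : ℤ) : Option β := x[(t % x.length).toNat]?

theorem biPow_natCast {β : Type*} (x : List β) (t : ℕ) : biPow x t = infPow x t := by
  rw [biPow, infPow, ← Int.natCast_mod, Int.toNat_natCast]

theorem biPow_emod {β : Type*} {x : List β} {p : ℤ} (hp : (x.length : ℤ) ∣ p) (t : ℤ) :
    biPow x (t % p) = biPow x t := by
  rw [biPow, biPow, Int.emod_emod_of_dvd t hp]

theorem biPow_rotate {β : Type*} {x : List β} (hx : x ≠ []) (k : ℕ) (t : ℤ) :
    biPow (x.rotate k) t = biPow x (t + k) := by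
  have hl : 0 < x.length := List.length_pos_iff.2 hx
  have h1 := Int.emod_nonneg t (show (x.length : ℤ) ≠ 0 by omega)
  have h2 := Int.emod_lt_of_pos t (show (0 : ℤ) < x.length by omega)
  rw [biPow, biPow, List.length_rotate, List.getElem?_rotate (by omega), ← Int.emod_add_emod]
  congr 1
  rw [← Int.toNat_of_nonneg h1, ← Nat.cast_add, ← Int.natCast_mod, Int.toNat_natCast,
    Int.toNat_natCast]

theorem biPow_neg_one {β : Type*} {x : List β} (hx : x ≠ []) : biPow x (-1) = x.getLast? := by
  have hl : 0 < x.length := List.length_pos_iff.2 hx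
  rw [biPow, List.getLast?_eq_getElem?]
  have : (-1 : ℤ) % x.length = x.length - 1 := by
    rw [← Int.add_emod_right, Int.emod_eq_of_lt] <;> omega
  rw [this]
  congr 1; omega

/-- Two bi-infinite powers that agree on a common period are equal. -/
theorem biPow_eq_of_agree {β : Type*} {x y : List β} (hx : x ≠ []) (hy : y ≠ [])
    (h : ∀ t : ℕ, t < x.length * y.length → biPow x t = biPow y t) : biPow x = biPow y := by
  have hx : 0 < x.length := List.length_pos_iff.2 hx
  have hy : 0 < y.length := List.length_pos_iff.2 hy
  have hp : (0 : ℤ) < x.length * y.length := by positivity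
  funext t
  have h1 := Int.emod_nonneg t hp.ne'
  have h2 := Int.emod_lt_of_pos t hp
  rw [← biPow_emod (x := x) (p := x.length * y.length) (dvd_mul_right _ _),
    ← biPow_emod (x := y) (p := x.length * y.length) (dvd_mul_left _ _)]
  have := h (t % (x.length * y.length)).toNat (by zify; omega)
  rwa [Int.toNat_of_nonneg h1] at this

section Order

variable {α : Type*} [LinearOrder α]

theorem option_lt_trichotomy (a b : Option α) : a < b ∨ a = b ∨ b < a := by
  cases a <;> cases b <;> simp [lt_trichotomy]

theorem option_lt_irrefl (a : Option α) : ¬ a < a := by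
  cases a <;> simp

theorem option_lt_trans {a b c : Option α} (h : a < b) (h' : b < c) : a < c := by
  cases a <;> cases b <;> cases c <;> simp at h h' ⊢
  exact h.trans h'

theorem omegaLE_iff {x y : List α} : OmegaLE x y ↔ ∀ k, (∀ i < k, infPow x i = infPow y i) →
    infPow x k = infPow y k ∨ infPow x k < infPow y k := by
  constructor
  · rintro (h | ⟨l, h, hlt⟩) k hk
    · exact Or.inl (congrFun h k)
    · rcases lt_trichotomy k l with h1 | rfl | h1
      · exact Or.inl (h k h1)
      · exact Or.inr hlt
      · rw [hk l h1] at hlt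
        exact absurd hlt (option_lt_irrefl _)
  · intro h
    by_cases he : ∃ k, infPow x k ≠ infPow y k
    · classical
      have hmin : ∀ i < Nat.find he, infPow x i = infPow y i := fun i hi =>
        not_not.1 (Nat.find_min he hi)
      exact Or.inr ⟨Nat.find he, hmin, (h _ hmin).resolve_left (Nat.find_spec he)⟩
    · push Not at he
      exact Or.inl (funext he)

theorem OmegaLE.agree_of_agree {x y z : List α} (hxy : OmegaLE x y) (hyz : OmegaLE y z) {m : ℕ}
    (h : ∀ i < m, infPow x i = infPow z i) : ∀ i < m, infPow x i = infPow y i := by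
  intro i
  induction i using Nat.strong_induction_on with
  | _ i ih =>
    intro hi
    have hpre : ∀ j < i, infPow x j = infPow y j := fun j hj => ih j hj (hj.trans hi)
    rcases omegaLE_iff.1 hxy i hpre with h1 | h1
    · exact h1
    · rcases omegaLE_iff.1 hyz i
        (fun j hj => (hpre j hj).symm.trans (h j (hj.trans hi))) with h2 | h2
      · exact (h i hi).trans h2.symm
      · have := option_lt_trans h1 h2
        rw [h i hi] at this
        exact absurd this (option_lt_irrefl _)

theorem OmegaLE.trans {x y z : List α} (hxy : OmegaLE x y) (hyz : OmegaLE y z) : OmegaLE x z := by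
  rw [omegaLE_iff]
  intro k hk
  have hpre := hxy.agree_of_agree hyz hk
  rcases omegaLE_iff.1 hxy k hpre with h1 | h1 <;>
    rcases omegaLE_iff.1 hyz k (fun j hj => (hpre j hj).symm.trans (hk j hj)) with h2 | h2
  · exact Or.inl (h1.trans h2)
  · exact Or.inr (h1 ▸ h2)
  · exact Or.inr (h2 ▸ h1)
  · exact Or.inr (option_lt_trans h1 h2)

theorem omegaLE_total (x y : List α) : OmegaLE x y ∨ OmegaLE y x := by
  by_cases he : ∃ k, infPow x k ≠ infPow y k
  · classical
    have hmin : ∀ i < Nat.find he, infPow x i = infPow y i := fun i hi =>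
      not_not.1 (Nat.find_min he hi)
    rcases option_lt_trichotomy (infPow x (Nat.find he)) (infPow y (Nat.find he)) with h | h | h
    · exact Or.inl (Or.inr ⟨_, hmin, h⟩)
    · exact absurd h (Nat.find_spec he)
    · exact Or.inr (Or.inr ⟨_, fun i hi => (hmin i hi).symm, h⟩)
  · push Not at he
    exact Or.inl (Or.inl (funext he))

end Order

/-! ### The sorted list of rotations -/

/-- A list that is invariant under `g` up to a permutation is permuted by `g`. -/
theorem exists_perm_of_map_perm {β : Type*} {l : List β} {g : β → β} (h : l.map g ~ l) :
    ∃ σ : Equiv.Perm (Fin l.length), ∀ i, l.get (σ i) = g (l.get i) := by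
  have h1 : l.map g ~ (List.finRange l.length).map l.get := by
    rwa [List.map_get_finRange]
  rw [← congrFun (congrFun (List.eq_map_comp_perm l.get) _) _] at h1
  obtain ⟨p, hp, hperm⟩ := h1
  have hlen : p.length = l.length := by rw [hperm.length_eq, List.length_finRange]
  have hnd : p.Nodup := hperm.nodup_iff.2 (List.nodup_finRange _)
  let s : Fin l.length → Fin l.length := fun i => p.get (i.cast hlen.symm)
  have hs : Function.Injective s := fun i j hij => by
    have := hnd.injective_get hij
    exact Fin.cast_injective _ this
  refine ⟨Equiv.ofBijective s (Finite.injective_iff_bijective.1 hs), fun i => ?_⟩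
  have := congrArg (fun q => q[(i : ℕ)]?) hp
  simp only [List.getElem?_map] at this
  rw [List.getElem?_eq_getElem i.2, List.getElem?_eq_getElem (by omega)] at this
  simpa [s] using this.symm

theorem map_rotate_cyclicPermutations_perm {β : Type*} (x : List β) :
    x.cyclicPermutations.map (fun y => y.rotate 1) ~ x.cyclicPermutations := by
  have : x.cyclicPermutations.map (fun y => y.rotate 1) = x.cyclicPermutations.rotate 1 := by
    rw [← List.cyclicPermutations_rotate]
    refine List.ext_getElem ?_ fun i h1 h2 => ?_
    · rw [List.length_map, List.cyclicPermutations_rotate, List.length_rotate]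
    · rw [List.getElem_map, List.getElem_cyclicPermutations, List.getElem_cyclicPermutations,
        List.rotate_rotate, List.rotate_rotate, Nat.add_comm]
  rw [this]
  exact List.rotate_perm _ _

theorem length_flatMap_cyclicPermutations {β : Type*} {fs : List (List β)}
    (h : ∀ f ∈ fs, f ≠ []) :
    (fs.flatMap List.cyclicPermutations).length = fs.flatten.length := by
  induction fs with
  | nil => rfl
  | cons f fs ih =>
    rw [List.flatMap_cons, List.flatten_cons, List.length_append, List.length_append,
      ih fun g hg => h g (by simp [hg]),
      List.length_cyclicPermutations_of_ne_nil _ (h f (by simp))]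

/-- The positions of the concatenation of nonempty words enumerate all rotations of these words:
the rotation of `f` by `o` belongs to the position at offset `o` in `f`. -/
theorem getElem?_flatMap_cyclicPermutations {β : Type*} {l₁ l₂ : List (List β)} {f : List β}
    (h : ∀ g ∈ l₁ ++ f :: l₂, g ≠ []) {o : ℕ} (ho : o < f.length) :
    ((l₁ ++ f :: l₂).flatMap List.cyclicPermutations)[l₁.flatten.length + o]? =
      some (f.rotate o) := by
  have hf : f ≠ [] := h f (by simp)
  have hl := length_flatMap_cyclicPermutations fun g hg => h g (List.mem_append_left _ hg)
  rw [List.flatMap_append, List.getElem?_append_right (by omega), hl, Nat.add_sub_cancel_left,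
    List.flatMap_cons, List.getElem?_append_left (by
      rwa [List.length_cyclicPermutations_of_ne_nil _ hf]),
    List.getElem?_eq_getElem (by rwa [List.length_cyclicPermutations_of_ne_nil _ hf]),
    List.getElem_cyclicPermutations]

section Rotations

variable {α : Type*} [LinearOrder α]

theorem lyndonFactorization_ne_nil {w f : List α} (hf : f ∈ lyndonFactorization w) : f ≠ [] :=
  ((lyndonFactorization_spec w).2.1 f hf).1

theorem sortedRotations_perm (w : List α) :
    sortedRotations w ~ (lyndonFactorization w).flatMap List.cyclicPermutations :=
  List.mergeSort_perm _ _

theorem length_sortedRotations (w : List α) : (sortedRotations w).length = w.length := by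
  rw [(sortedRotations_perm w).length_eq,
    length_flatMap_cyclicPermutations fun f hf => lyndonFactorization_ne_nil hf,
    (lyndonFactorization_spec w).1]

theorem exists_rotate_of_mem_sortedRotations {w x : List α} (hx : x ∈ sortedRotations w) :
    ∃ f ∈ lyndonFactorization w, ∃ o < f.length, x = f.rotate o := by
  rw [(sortedRotations_perm w).mem_iff, List.mem_flatMap] at hx
  obtain ⟨f, hf, hx⟩ := hx
  obtain ⟨o, ho, rfl⟩ := List.getElem_of_mem hx
  rw [List.length_cyclicPermutations_of_ne_nil _ (lyndonFactorization_ne_nil hf)] at ho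
  exact ⟨f, hf, o, ho, List.getElem_cyclicPermutations _ _ _⟩

theorem ne_nil_of_mem_sortedRotations {w x : List α} (hx : x ∈ sortedRotations w) : x ≠ [] := by
  obtain ⟨f, hf, o, -, rfl⟩ := exists_rotate_of_mem_sortedRotations hx
  rw [Ne, List.rotate_eq_nil_iff]
  exact lyndonFactorization_ne_nil hf

theorem length_le_of_mem_sortedRotations {w x : List α} (hx : x ∈ sortedRotations w) :
    x.length ≤ w.length := by
  obtain ⟨f, hf, o, -, rfl⟩ := exists_rotate_of_mem_sortedRotations hx
  rw [List.length_rotate, ← (lyndonFactorization_spec w).1]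
  exact (List.sublist_flatten_of_mem hf).length_le

theorem map_rotate_sortedRotations_perm (w : List α) :
    (sortedRotations w).map (fun y => y.rotate 1) ~ sortedRotations w := by
  refine ((sortedRotations_perm w).map _).trans (List.Perm.trans ?_ (sortedRotations_perm w).symm)
  rw [List.map_flatMap]
  exact List.Perm.flatMap_left _ fun f _ => map_rotate_cyclicPermutations_perm f

theorem pairwise_sortedRotations (w : List α) : (sortedRotations w).Pairwise OmegaLE := by
  classical
  refine (List.pairwise_mergeSort ?_ ?_ _).imp ?_
  · simp only [decide_eq_true_eq]
    exact fun a b c => OmegaLE.trans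
  · simpa using omegaLE_total
  · simp

end Rotations

/-! ### Counting windows and runs -/

section Count

variable {α : Type*} [LinearOrder α]

/-- The bi-infinite powers of all rotations of the Lyndon factors of a word of length `n + 1`, in
`ω`-order. -/
noncomputable def rotationPow (w : List α) {n : ℕ} (hn : w.length = n + 1) (i : Fin (n + 1)) :
    ℤ → Option α :=
  biPow ((sortedRotations w).get (i.cast (by rw [length_sortedRotations, hn])))

theorem prefixConvex_rotationPow (w : List α) {n : ℕ} (hn : w.length = n + 1) :
    PrefixConvex (rotationPow w hn) := by
  have hle : ∀ i j : Fin (sortedRotations w).length, i ≤ j →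
      OmegaLE ((sortedRotations w).get i) ((sortedRotations w).get j) := by
    intro i j hij
    rcases hij.lt_or_eq with h | rfl
    · exact List.pairwise_iff_get.1 (pairwise_sortedRotations w) i j h
    · exact Or.inl rfl
  intro m i j k hij hjk h
  simp only [rotationPow, biPow_natCast] at h ⊢
  exact (hle _ _ hij).agree_of_agree (hle _ _ hjk) h

theorem exists_shift_rotationPow (w : List α) {n : ℕ} (hn : w.length = n + 1) :
    ∃ σ : Equiv.Perm (Fin (n + 1)),
      ∀ i x, rotationPow w hn (σ i) x = rotationPow w hn i (x + 1) := by
  obtain ⟨σ, hσ⟩ := exists_perm_of_map_perm (map_rotate_sortedRotations_perm w)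
  have hl : (sortedRotations w).length = n + 1 := by rw [length_sortedRotations, hn]
  refine ⟨(finCongr hl).permCongr σ, fun i x => ?_⟩
  have h1 := hσ (i.cast hl.symm)
  have h2 := biPow_rotate (ne_nil_of_mem_sortedRotations (List.get_mem _ (i.cast hl.symm))) 1 x
  simp only [rotationPow]
  rw [Nat.cast_one, ← h1] at h2
  exact h2

/-- There are at most `3zm` windows of length `m > 0` in the powers of the Lyndon factors: at most
`zm` of them occur in `w`, and the others start at one of the `2m` positions before a phrase
end. -/
theorem card_windows_rotationPow_le (w : List α) {n : ℕ} (hn : w.length = n + 1) {m : ℕ}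
    (hm : 0 < m) : (windows (rotationPow w hn) m).card ≤ 3 * (lz77 w).length * m := by
  classical
  obtain ⟨E, hE1, hE0, hE⟩ := exists_phraseEnds w
  set R := (lyndonFactorization w).flatMap List.cyclicPermutations with hR
  let U := E.biUnion fun e => Finset.Ico (e - m) e
  let V := E.biUnion fun e => Finset.Ico (e - 2 * m) e
  have hU : U.card ≤ E.card * m := by
    refine Finset.card_biUnion_le_card_mul _ _ _ fun e _ => ?_
    rw [Nat.card_Ico]; omega
  have hV : V.card ≤ E.card * (2 * m) := by
    refine Finset.card_biUnion_le_card_mul _ _ _ fun e _ => ?_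
    rw [Nat.card_Ico]; omega
  have hsub : windows (rotationPow w hn) m ⊆
      U.image (fun (b : ℕ) (x : Fin m) => w[b + x]?) ∪
        V.image (fun (q : ℕ) (x : Fin m) => infPow (R[q]?.getD []) x) := by
    intro s hs
    simp only [windows, Finset.mem_image, Finset.mem_univ, true_and] at hs
    obtain ⟨i, rfl⟩ := hs
    obtain ⟨f, hf, o, ho, hx⟩ := exists_rotate_of_mem_sortedRotations
      (List.get_mem (sortedRotations w) (i.cast (by rw [length_sortedRotations, hn])))
    have hrot : ∀ x : ℕ, infPow (f.rotate o) x = infPow f (o + x) := by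
      intro x
      rw [← biPow_natCast, biPow_rotate (lyndonFactorization_ne_nil hf), ← Nat.cast_add,
        biPow_natCast, Nat.add_comm]
    have hF : ∀ x : ℕ, rotationPow w hn i x = infPow (f.rotate o) x := by
      intro x
      rw [rotationPow, hx, biPow_natCast]
    obtain ⟨l₁, l₂, hl⟩ := List.append_of_mem hf
    have hw := lyndonFactorization_spec w
    rw [hl] at hw
    rw [Finset.mem_union, Finset.mem_image, Finset.mem_image]
    rcases window_mem_or hw (hE0 (by omega)) hE hm ho with ⟨e, he, b, h1, h2, h3⟩ | ⟨e, he, h1, h2⟩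
    · refine Or.inl ⟨b, ?_, funext fun x => ?_⟩
      · exact Finset.mem_biUnion.2 ⟨e, he, Finset.mem_Ico.2 ⟨by omega, h2⟩⟩
      · rw [hF, hrot, h3 x x.2]
    · refine Or.inr ⟨l₁.flatten.length + o, ?_, funext fun x => ?_⟩
      · exact Finset.mem_biUnion.2 ⟨e, he, Finset.mem_Ico.2 ⟨by omega, h2⟩⟩
      · rw [hF, hR, hl, getElem?_flatMap_cyclicPermutations (fun g hg => (hw.2.1 g hg).1) ho,
          Option.getD_some]
  refine (Finset.card_le_card hsub).trans ((Finset.card_union_le _ _).trans ?_)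
  calc _ ≤ E.card * m + E.card * (2 * m) :=
        add_le_add (Finset.card_image_le.trans hU) (Finset.card_image_le.trans hV)
    _ = 3 * E.card * m := by ring
    _ ≤ _ := Nat.mul_le_mul_right _ (Nat.mul_le_mul_left _ hE1)

theorem map_some_filterMap_getLast? {β : Type*} {l : List (List β)} (h : ∀ x ∈ l, x ≠ []) :
    (l.filterMap List.getLast?).map some = l.map List.getLast? := by
  induction l with
  | nil => rfl
  | cons x l ih =>
    rw [List.filterMap_cons_some (List.getLast?_eq_some_getLast (h x (by simp))), List.map_cons,
      List.map_cons, ih fun y hy => h y (by simp [hy]),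
      List.getLast?_eq_some_getLast (h x (by simp))]

open Classical in
/-- The symbols of the transform are the left symbols of the sorted bi-infinite strings, so that a
run starts at the first position or where two adjacent left symbols differ. -/
theorem rB_le (w : List α) {n : ℕ} (hn : w.length = n + 1) :
    rB w ≤ (Finset.univ.filter fun i : Fin n =>
      rotationPow w hn i.castSucc (-1) ≠ rotationPow w hn i.succ (-1)).card + 1 := by
  have hl : (sortedRotations w).length = n + 1 := by rw [length_sortedRotations, hn]
  have hmap : (bbwt w).map some = (sortedRotations w).map List.getLast? :=
    map_some_filterMap_getLast? fun x hx => ne_nil_of_mem_sortedRotations hx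
  have hlen : (bbwt w).length = n + 1 := by
    have := congrArg List.length hmap
    rwa [List.length_map, List.length_map, hl] at this
  have hget : ∀ i : Fin (n + 1), (bbwt w)[(i : ℕ)]? = rotationPow w hn i (-1) := by
    intro i
    rw [rotationPow, biPow_neg_one (ne_nil_of_mem_sortedRotations (List.get_mem _ _))]
    have := congrArg (fun l => l[(i : ℕ)]?) hmap
    simp only [List.getElem?_map] at this
    rw [List.getElem?_eq_getElem (by omega), List.getElem?_eq_getElem (by omega), Option.map_some,
      Option.map_some, Option.some_inj] at this
    rw [List.getElem?_eq_getElem (by omega), this]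
    rfl
  rw [rB, numRuns]
  refine (Finset.card_le_card (t := insert 0 ((Finset.univ.filter fun i : Fin n =>
    rotationPow w hn i.castSucc (-1) ≠ rotationPow w hn i.succ (-1)).image
      fun i : Fin n => (i : ℕ) + 1)) ?_).trans ((Finset.card_insert_le _ _).trans
        (Nat.add_le_add_right Finset.card_image_le 1))
  intro i hi
  simp only [Finset.mem_filter, Finset.mem_range, hlen] at hi
  rw [Finset.mem_insert, Finset.mem_image]
  rcases Nat.eq_zero_or_pos i with h0 | h0
  · exact Or.inl h0
  · have hne := hi.2.resolve_left h0.ne'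
    refine Or.inr ⟨⟨i - 1, by omega⟩, ?_, Nat.sub_add_cancel h0⟩
    rw [Finset.mem_filter, ← hget, ← hget]
    refine ⟨Finset.mem_univ _, ?_⟩
    simpa [Nat.sub_add_cancel h0] using hne

theorem rB_le_mul_log (w : List α) {n : ℕ} (hn : w.length = n + 1) :
    rB w ≤ 3 * (lz77 w).length +
      (2 * (Nat.log 2 (n + 1) + 1)) * (6 * (3 * (lz77 w).length) * Nat.log 2 (n + 1)) + 1 := by
  obtain ⟨σ, hσ⟩ := exists_shift_rotationPow w hn
  refine (rB_le w hn).trans (Nat.add_le_add_right ?_ 1)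
  have key := card_ne_le hσ (prefixConvex_rotationPow w hn)
    (fun m hm => card_windows_rotationPow_le w hn hm)
    (d := 2 * (Nat.log 2 (n + 1) + 1)) fun i j h => ?_
  · convert key
  refine biPow_eq_of_agree (ne_nil_of_mem_sortedRotations (List.get_mem _ _))
    (ne_nil_of_mem_sortedRotations (List.get_mem _ _)) fun t ht => h t (ht.trans_le ?_)
  have hlog : w.length ≤ 2 ^ (Nat.log 2 (n + 1) + 1) := by
    rw [hn]; exact (Nat.lt_pow_succ_log_self (by norm_num) _).le
  rw [two_mul, pow_add]
  exact Nat.mul_le_mul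
    ((length_le_of_mem_sortedRotations (List.get_mem _ _)).trans hlog)
    ((length_le_of_mem_sortedRotations (List.get_mem _ _)).trans hlog)

theorem one_le_length_lz77 {β : Type*} {w : List β} (hw : 0 < w.length) :
    1 ≤ (lz77 w).length := by
  rw [lz77, lzFactorsFrom, if_pos hw, List.length_cons]
  exact Nat.le_add_left _ _

end Count

end Strings

theorem mainTheorem1 :
    ∃ C : ℝ, 0 < C ∧ ∀ (α : Type*) [LinearOrder α] (w : List α), 2 ≤ w.length →
      (Strings.rB w : ℝ) ≤
        C * ((Strings.lz77 w).length : ℝ) * (Real.logb 2 (w.length : ℝ)) ^ 2 := by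
  refine ⟨76, by norm_num, fun α _ w hw => ?_⟩
  obtain ⟨n, hn⟩ : ∃ n, w.length = n + 1 := ⟨w.length - 1, by omega⟩
  have h := Strings.rB_le_mul_log w hn
  have hz := Strings.one_le_length_lz77 (w := w) (by omega)
  rw [← hn] at h
  have hL : 1 ≤ Nat.log 2 w.length := Nat.le_log_of_pow_le (by norm_num) (by simpa using hw)
  have hlog : (Nat.log 2 w.length : ℝ) ≤ Real.logb 2 w.length := by
    simpa using Real.natLog_le_logb w.length 2
  generalize (Strings.lz77 w).length = z at *
  generalize Nat.log 2 w.length = l at *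
  -- The terms `3z` and `1` are absorbed by means of `1 ≤ z` and `1 ≤ log₂ n`.
  have hb : Strings.rB w ≤ 76 * z * l ^ 2 := by
    have h1 : z * l ≤ z * l ^ 2 := Nat.mul_le_mul_left _ (Nat.le_self_pow two_ne_zero l)
    have h2 : z ≤ z * l := Nat.le_mul_of_pos_right _ hL
    have h3 : 2 * (l + 1) * (6 * (3 * z) * l) = 36 * (z * l ^ 2) + 36 * (z * l) := by ring
    rw [mul_assoc]
    omega
  calc (Strings.rB w : ℝ) ≤ 76 * z * (l : ℝ) ^ 2 := by exact_mod_cast hb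
    _ ≤ 76 * z * (Real.logb 2 w.length) ^ 2 := by gcongr
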